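/- Let $p$ be a prime and let $K$ be a nonarchimedean local field whose residue field has $p$ elements (for instance $\mathbb F_p((t))$), with absolute value normalized by $|\mathfrak p|=p^{-1}$ for a prime element $\mathfrak p$, ring of integers $\mathcal D=\{|x|\le 1\}$ with characteristic function $\Phi$, and Haar measure $dx$ on $K$ normalized by $|\mathcal D|=1$. Let $\chi$ be a continuous unitary character of $(K,+)$ that is trivial on $\mathcal D$ and nontrivial on $\mathfrak p^{-1}\mathcal D$. Let $\mathcal S(K)$ be the space of locally constant compactly supported functions $K\to\mathbb C$, let $\hat\varphi(\xi)=\int_K\varphi(x)\chi(-\xi x)\,dx$, let $\mathcal S'(K)$ be the space of tempered distributions (continuous linear functionals on $\mathcal S(K)$), and define $\langle\hat T,\varphi\rangle=\langle T,\hat\varphi\rangle$ for $T\in\mathcal S'(K)$. For $\mathfrak s\in\mathbb R$, $H^{\mathfrak s}(K)$ consists of the $T\in\mathcal S'(K)$ whose Fourier transform is a locally integrable function with $\int_K(1+|\xi|^2)^{\mathfrak s}|\hat T(\xi)|^2\,d\xi<\infty$. For real $\alpha\ne0$ let $\pi_\alpha$ be the distribution $$\langle\pi_\alpha,\varphi\rangle=\int_K\varphi(x)|x|^{\alpha-1}\,dx\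 \ (\alpha>0),\qquad \langle\pi_\alpha,\varphi\rangle=\int_K(\varphi(x)-\varphi(0))|x|^{\alpha-1}\,dx\ \ (\alpha<0).$$ For $\theta\in\mathbb R$ let $$\kappa_\theta=\begin{cases}\left(\dfrac{1-p^{\theta}}{1-p^{-\theta-1}}\,\pi_{-\theta}+\dfrac{1-p^{\theta}}{1-p^{\theta+1}}\right)\Phi,&\theta\ne0,-1,\\[2mm]\delta,&\theta=0,\\[1mm]\left(1-\tfrac1p\right)\left(1-\log_p|x|\right)\Phi(x),&\theta=-1.\end{cases}$$ Then $\kappa_\theta$ is a tempered distribution, its Fourier transform is the function $\hat\kappa_\theta(\xi)=\max(1,|\xi|)^{\theta}$, and $\kappa_\theta\in H^{\mathfrak s}(K)$ for every real $\mathfrak s<-(1+2\theta)/2$. -/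

import Mathlib

open MeasureTheory Metric Filter Topology

noncomputable section

namespace LocalFieldSobolev

section Defs

variable {K : Type*} [NontriviallyNormedField K] [IsUltrametricDist K]

variable (K) in
/-- The Schwartz space of a nonarchimedean local field `K` (Schwartz-Bruhat functions):
locally constant functions with compact support. -/
def Schwartz : Submodule ℂ (K → ℂ) where
  carrier := {φ | IsLocallyConstant φ ∧ HasCompactSupport φ}
  add_mem' := fun ha hb => ⟨ha.1.add hb.1, ha.2.add hb.2⟩
  zero_mem' := ⟨IsLocallyConstant.const 0, HasCompactSupport.zero⟩
  smul_mem' := fun c φ h => by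
    refine ⟨h.1.comp (fun z => c • z), ?_⟩
    exact h.2.comp_left (g := fun z => c • z) (smul_zero c)

variable (K) in
/-- The characteristic function of the ring of integers `{x | ‖x‖ ≤ 1}`. -/
def unitBallIndicator : K → ℂ := (closedBall (0 : K) 1).indicator 1

/-- The product of the characteristic function of the ring of integers with a Schwartz
function. -/
def cutoff (φ : Schwartz K) : Schwartz K :=
  ⟨fun x => unitBallIndicator K x * φ.1 x, by
    have h1 : IsLocallyConstant (unitBallIndicator K) := by
      rw [unitBallIndicator, ← LocallyConstant.coe_charFn ℂ
        (IsUltrametricDist.isClopen_closedBall (0 : K) one_ne_zero)]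
      exact LocallyConstant.isLocallyConstant _
    exact ⟨h1.mul φ.2.1, φ.2.2.mul_left⟩⟩

/-- Convergence to zero in the Schwartz space: common compact support in a ball, a common ball
by whose elements all translations leave the functions fixed, and uniform convergence to zero. -/
def TendsToZero (φ : ℕ → Schwartz K) : Prop :=
  (∃ R : ℝ, ∀ n x, R < ‖x‖ → (φ n).1 x = 0) ∧
  (∃ δ : ℝ, 0 < δ ∧ ∀ n x h, ‖h‖ ≤ δ → (φ n).1 (x + h) = (φ n).1 x) ∧
  TendstoUniformly (fun n => (φ n).1) 0 atTop

/-- A tempered distribution: a continuous linear functional on the Schwartz space. -/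
structure IsTemperedDistribution (T : Schwartz K → ℂ) : Prop where
  map_add : ∀ φ ψ, T (φ + ψ) = T φ + T ψ
  map_smul : ∀ (c : ℂ) φ, T (c • φ) = c * T φ
  continuous : ∀ φ : ℕ → Schwartz K, TendsToZero φ → Tendsto (fun n => T (φ n)) atTop (𝓝 0)

variable (K) in
/-- A continuous unitary additive character of `K` which is trivial on the ring of integers
`{‖x‖ ≤ 1}` and nontrivial on the fractional ideal `{‖x‖ ≤ p}`. -/
structure StandardCharacter (p : ℕ) where
  /-- the underlying additive character -/
  char : AddChar K Circle
  continuous_char : Continuous char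
  trivial_on_integers : ∀ x, ‖x‖ ≤ 1 → char x = 1
  nontrivial_on_inverse_prime : ∃ x, ‖x‖ ≤ p ∧ char x ≠ 1

theorem Schwartz.exists_translation_invariant (φ : Schwartz K) :
    ∃ δ : ℝ, 0 < δ ∧ ∀ x h, ‖h‖ < δ → φ.1 (x + h) = φ.1 x := by
  have huc : UniformContinuous φ.1 := φ.2.2.uniformContinuous_of_continuous φ.2.1.continuous
  have hfin : (Set.range φ.1).Finite := by
    have h2 : (φ.1 '' (tsupport φ.1)).Finite := by
      have hc : IsCompact (tsupport φ.1) := φ.2.2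
      obtain ⟨t, ht⟩ := hc.elim_finite_subcover (fun c : ℂ => φ.1 ⁻¹' {c})
        (fun c => φ.2.1 {c}) (fun x _ => Set.mem_iUnion.2 ⟨φ.1 x, rfl⟩)
      refine t.finite_toSet.subset ?_
      rintro _ ⟨x, hx, rfl⟩
      obtain ⟨c, hc, hxc⟩ := Set.mem_iUnion₂.1 (ht hx)
      have : φ.1 x = c := hxc
      simpa [this] using hc
    refine (h2.insert 0).subset ?_
    rintro _ ⟨x, rfl⟩
    by_cases hx : x ∈ tsupport φ.1
    · exact Or.inr ⟨x, hx, rfl⟩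
    · exact Or.inl (image_eq_zero_of_notMem_tsupport hx)
  obtain ⟨ε, hε, hsep⟩ : ∃ ε : ℝ, 0 < ε ∧ ∀ a ∈ Set.range φ.1, ∀ b ∈ Set.range φ.1,
      dist a b < ε → a = b := by
    obtain ⟨C, hC, h⟩ := hfin.relatively_discrete
    have hm : 0 < min C 1 := lt_min hC one_pos
    have hm' : min C 1 ≠ ⊤ := ((min_le_right _ _).trans_lt ENNReal.one_lt_top).ne
    refine ⟨(min C 1).toReal, ENNReal.toReal_pos hm.ne' hm', fun a ha b hb hab => ?_⟩
    by_contra hne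
    rw [dist_edist, ENNReal.toReal_lt_toReal (edist_ne_top _ _) hm'] at hab
    exact absurd (h a ha b hb hne) (not_le.2 (hab.trans_le (min_le_left _ _)))
  obtain ⟨δ, hδ, h⟩ := Metric.uniformContinuous_iff.1 huc ε hε
  refine ⟨δ, hδ, fun x k hk => hsep _ ⟨_, rfl⟩ _ ⟨_, rfl⟩ (h ?_)⟩
  simpa [dist_eq_norm] using hk

variable [LocallyCompactSpace K] [MeasurableSpace K] [BorelSpace K]

/-- The Fourier transform `ξ ↦ ∫ φ(x) χ(-ξ x) dx` of a function on `K`. -/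
def fourierIntegral {p : ℕ} (χ : StandardCharacter K p) (μ : Measure K) (φ : K → ℂ) (ξ : K) : ℂ :=
  ∫ x, φ x * (χ.char (-(ξ * x)) : ℂ) ∂μ

theorem fourierIntegral_mem {p : ℕ} (χ : StandardCharacter K p) (μ : Measure K)
    [μ.IsAddHaarMeasure] (φ : Schwartz K) : fourierIntegral χ μ φ.1 ∈ Schwartz K := by
  have : ProperSpace K := ProperSpace.of_locallyCompactSpace K
  have hmul : ∀ a b : K, ((χ.char (a + b) : Circle) : ℂ) = χ.char a * χ.char b := fun a b => by
    rw [AddChar.map_add_eq_mul, Circle.coe_mul]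
  constructor
  · obtain ⟨R, hR⟩ := φ.2.2.isBounded.exists_norm_le
    have hR1 : 0 < max R 1 := lt_max_of_lt_right one_pos
    rw [IsLocallyConstant.iff_exists_open]
    intro ξ
    refine ⟨ball ξ (max R 1)⁻¹, isOpen_ball, mem_ball_self (inv_pos.2 hR1), fun η hη => ?_⟩
    refine integral_congr_ae (ae_of_all _ fun x => ?_)
    by_cases hx : x ∈ tsupport φ.1
    · have h1 : χ.char (-((η - ξ) * x)) = 1 := by
        refine χ.trivial_on_integers _ ?_
        rw [norm_neg, norm_mul]
        have h2 : ‖η - ξ‖ ≤ (max R 1)⁻¹ := by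
          rw [← dist_eq_norm]; exact (mem_ball.1 hη).le
        calc ‖η - ξ‖ * ‖x‖ ≤ (max R 1)⁻¹ * max R 1 :=
              mul_le_mul h2 ((hR x hx).trans (le_max_left _ _)) (norm_nonneg _)
                (inv_pos.2 hR1).le
          _ = 1 := inv_mul_cancel₀ hR1.ne'
      have h3 : -(η * x) = -(ξ * x) + -((η - ξ) * x) := by ring
      simp only [h3, hmul, h1, Circle.coe_one, mul_one]
    · simp [image_eq_zero_of_notMem_tsupport hx]
  · obtain ⟨δ, hδ, hinv⟩ := Schwartz.exists_translation_invariant φ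
    obtain ⟨y, -, hy⟩ := χ.nontrivial_on_inverse_prime
    refine HasCompactSupport.intro (isCompact_closedBall (0 : K) (‖y‖ / δ)) fun ξ hξ => ?_
    have hξ' : ‖y‖ / δ < ‖ξ‖ := by simpa using hξ
    have hpos : 0 < ‖ξ‖ := lt_of_le_of_lt (by positivity) hξ'
    have hξ0 : ξ ≠ 0 := norm_pos_iff.1 hpos
    have hh : ‖-(y / ξ)‖ < δ := by
      rw [norm_neg, norm_div, div_lt_iff₀ hpos]
      rwa [div_lt_iff₀ hδ, mul_comm] at hξ'
    have key : fourierIntegral χ μ φ.1 ξ = (χ.char y : ℂ) * fourierIntegral χ μ φ.1 ξ := by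
      unfold fourierIntegral
      conv_lhs => rw [← integral_add_right_eq_self _ (-(y / ξ))]
      rw [← integral_const_mul]
      refine integral_congr_ae (ae_of_all _ fun x => ?_)
      have h3 : -(ξ * (x + -(y / ξ))) = y + -(ξ * x) := by
        field_simp
        ring
      simp only [h3, hmul, hinv x _ hh]
      ring
    have hy' : (χ.char y : ℂ) ≠ 1 := fun h => hy (Circle.ext (by simpa using h))
    by_contra hne
    exact hy' (mul_right_cancel₀ hne (by rw [one_mul]; exact key.symm))

/-- The Fourier transform as a map of the Schwartz space into itself. -/
def fourierSchwartz {p : ℕ} (χ : StandardCharacter K p) (μ : Measure K) [μ.IsAddHaarMeasure]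
    (φ : Schwartz K) : Schwartz K :=
  ⟨fourierIntegral χ μ φ.1, fourierIntegral_mem χ μ φ⟩

/-- The Fourier transform of a distribution, `⟨T^, φ⟩ = ⟨T, φ^⟩`. -/
def fourierDistribution {p : ℕ} (χ : StandardCharacter K p) (μ : Measure K) [μ.IsAddHaarMeasure]
    (T : Schwartz K → ℂ) : Schwartz K → ℂ :=
  fun φ => T (fourierSchwartz χ μ φ)

/-- The distribution `φ ↦ ∫ f(x) φ(x) dx` given by a (locally integrable) function `f`. -/
def ofFunction (μ : Measure K) (f : K → ℂ) : Schwartz K → ℂ :=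
  fun φ => ∫ x, f x * φ.1 x ∂μ

/-- Membership in the Sobolev space `H^s(K)`: a tempered distribution whose Fourier transform
is (given by) a function `g` with `∫ (1 + |ξ|²)^s |g(ξ)|² dξ < ∞`. -/
def MemSobolev {p : ℕ} (χ : StandardCharacter K p) (μ : Measure K) [μ.IsAddHaarMeasure]
    (s : ℝ) (T : Schwartz K → ℂ) : Prop :=
  IsTemperedDistribution T ∧
    ∃ g : K → ℂ, LocallyIntegrable g μ ∧
      fourierDistribution χ μ T = ofFunction μ g ∧
      Integrable (fun ξ => (1 + ‖ξ‖ ^ 2) ^ s * ‖g ξ‖ ^ 2) μ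

/-- The homogeneous distribution `π_α` attached to `|x|^(α - 1)`, for real `α ≠ 0`: the locally
integrable function itself if `α > 0`, and its regularization by subtracting `φ(0)` if `α < 0`.
(The value at `α = 0` has no meaning and is not used.) -/
def homogeneousDistribution (μ : Measure K) (α : ℝ) : Schwartz K → ℂ :=
  fun φ =>
    if 0 < α then ∫ x, φ.1 x * ((‖x‖ ^ (α - 1) : ℝ) : ℂ) ∂μ
    else ∫ x, (φ.1 x - φ.1 0) * ((‖x‖ ^ (α - 1) : ℝ) : ℂ) ∂μ

/-- The distribution `κ_θ`. For `θ ≠ 0, -1` it is the product of the distribution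
`(1 - p^θ) / (1 - p^(-θ-1)) π_{-θ} + (1 - p^θ) / (1 - p^(θ+1))`
with the characteristic function of the ring of integers. -/
def kappa (p : ℕ) (μ : Measure K) (θ : ℝ) : Schwartz K → ℂ :=
  fun φ =>
    if θ = 0 then φ.1 0
    else if θ = -1 then
      ofFunction μ (fun x => ((1 - 1 / (p : ℝ)) * (1 - Real.logb p ‖x‖) : ℝ)
        * unitBallIndicator K x) φ
    else
      (((1 - (p : ℝ) ^ θ) / (1 - (p : ℝ) ^ (-θ - 1)) : ℝ) : ℂ)
          * homogeneousDistribution μ (-θ) (cutoff φ)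
        + (((1 - (p : ℝ) ^ θ) / (1 - (p : ℝ) ^ (θ + 1)) : ℝ) : ℂ)
          * ofFunction μ (fun _ => 1) (cutoff φ)

end Defs

end LocalFieldSobolev

end

/-! Both sides are cut into layers indexed by balls. Put `t = p^θ`. On `|ξ| ≤ p^N` the function
`max(1,|ξ|)^θ` telescopes to `t^N` plus the sum over `n < N` of `(1 - t) t^n` times the indicator of
`|ξ| ≤ p^n` (`max_one_norm_rpow_eq`). Orthogonality of characters makes `p^n` times the indicator of
`|x| ≤ p^(-n)` dual to the indicator of `|ξ| ≤ p^n` (`integral_fourierIntegral_closedBall`). This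
predicts the value of `κ_θ` on functions constant near the origin: it is `layerFunctional`.

In the variable `x`, the layers containing a point with `|x| = p^(-m)` add up to a geometric sum of
ratio `p^(θ+1)`. It equals `a |x|^(-θ-1) + b` for `θ ≠ -1` and is linear in `m = -log_p |x|` for `θ
= -1`: these are the kernels defining `κ_θ`. The identification is `kappa_eq_layerFunctional`, from
which temperedness and the Fourier transform follow by finite sums. The Sobolev condition is then
convergence of the integral of `|ξ|^(2s+2θ)` over `|ξ| > 1`, that is `2s + 2θ + 1 < 0`. -/

namespace LocalFieldSobolev

/-! ### Value group and volumes of balls. -/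

section

/-- If `q^n ≤ ‖x‖ < q^(n+1)`, then `x ϖ^(n+1)` has norm below `1`, hence at most `q⁻¹` by maximality
of `ϖ`. -/
theorem exists_norm_eq_zpow {K : Type*} [NormedField K] {q : ℝ} (hq : 1 < q) {ϖ : K} (hϖ : ‖ϖ‖ = q⁻¹)
    (hmax : ∀ x : K, ‖x‖ < 1 → ‖x‖ ≤ ‖ϖ‖) {x : K} (hx : x ≠ 0) : ∃ n : ℤ, ‖x‖ = q ^ n := by
  have hq0 : 0 < q := one_pos.trans hq
  obtain ⟨n, hn1, hn2⟩ := exists_mem_Ico_zpow (norm_pos_iff.2 hx) hq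
  refine ⟨n, le_antisymm ?_ hn1⟩
  have hnorm : ‖x * ϖ ^ (n + 1)‖ = ‖x‖ / q ^ (n + 1) := by
    rw [norm_mul, norm_zpow, hϖ, inv_zpow, div_eq_mul_inv]
  have h := hmax (x * ϖ ^ (n + 1)) (by
    rw [hnorm, div_lt_one (zpow_pos hq0 _)]; exact hn2)
  rw [hnorm, hϖ, div_le_iff₀ (zpow_pos hq0 _), zpow_add_one₀ hq0.ne'] at h
  calc ‖x‖ ≤ q⁻¹ * (q ^ n * q) := h
    _ = q ^ n := by field_simp

variable {K : Type*} [NontriviallyNormedField K] [IsUltrametricDist K]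

theorem residue_eq_iff_norm_sub_lt_one
    (x y : (NormedField.valuation (K := K)).valuationSubring) :
    IsLocalRing.residue _ x = IsLocalRing.residue _ y ↔ ‖(x : K) - y‖ < 1 := by
  rw [← sub_eq_zero, ← map_sub, IsLocalRing.residue_eq_zero_iff,
    IsLocalRing.mem_maximalIdeal, mem_nonunits_iff, iff_comm]
  have hle : ∀ z : (NormedField.valuation (K := K)).valuationSubring, ‖(z : K)‖ ≤ 1 := fun z => by
    have := (Valuation.mem_valuationSubring_iff _ _).1 z.2
    rw [NormedField.valuation_apply] at this
    exact_mod_cast this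
  set z := x - y with hz
  have hzc : (z : K) = x - y := by simp [hz]
  rw [← hzc]
  constructor
  · rintro hlt ⟨u, hu⟩
    have h1 : (z : K) * ((u⁻¹ : _ˣ) : (NormedField.valuation (K := K)).valuationSubring) = 1 := by
      rw [← hu]; exact_mod_cast congrArg Subtype.val u.mul_inv
    have h2 := congrArg norm h1
    rw [norm_mul, norm_one] at h2
    have := hle ((u⁻¹ : _ˣ) : (NormedField.valuation (K := K)).valuationSubring)
    nlinarith [norm_nonneg (z : K)]
  · intro hnu
    refine lt_of_le_of_ne (hle z) fun h1 => hnu ?_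
    have hz0 : (z : K) ≠ 0 := norm_ne_zero_iff.1 (by rw [h1]; exact one_ne_zero)
    refine IsUnit.of_mul_eq_one
      (⟨(z : K)⁻¹, ?_⟩ : (NormedField.valuation (K := K)).valuationSubring)
      (Subtype.ext (mul_inv_cancel₀ hz0))
    rw [Valuation.mem_valuationSubring_iff, NormedField.valuation_apply]
    rw [← NNReal.coe_le_coe]
    simp [h1]

theorem measure_closedBall_center {K : Type*} [NormedAddCommGroup K] [MeasurableSpace K]
    [BorelSpace K] (μ : Measure K)
    [μ.IsAddLeftInvariant] (x : K) (r : ℝ) : μ (closedBall x r) = μ (closedBall 0 r) := by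
  rw [← measure_preimage_add μ x (closedBall x r)]
  congr 1
  ext y
  simp [dist_eq_norm]

/-- Multiples by `a` of representatives of the residue classes are the centres of disjoint
translates of the smaller ball that fill the larger one. -/
theorem measure_closedBall_norm_eq_card_mul [MeasurableSpace K] [BorelSpace K] (μ : Measure K)
    [μ.IsAddLeftInvariant]
    [Finite (IsLocalRing.ResidueField (NormedField.valuation (K := K)).valuationSubring)]
    {ϖ : K} (hϖ : ‖ϖ‖ < 1) (hmax : ∀ x : K, ‖x‖ < 1 → ‖x‖ ≤ ‖ϖ‖) {a : K} (ha : a ≠ 0) :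
    μ (closedBall 0 ‖a‖) =
      Nat.card (IsLocalRing.ResidueField (NormedField.valuation (K := K)).valuationSubring)
        * μ (closedBall 0 (‖a‖ * ‖ϖ‖)) := by
  set k := IsLocalRing.ResidueField (NormedField.valuation (K := K)).valuationSubring
  have := Fintype.ofFinite k
  choose r hr using IsLocalRing.residue_surjective
    (R := (NormedField.valuation (K := K)).valuationSubring)
  have ha' : 0 < ‖a‖ := norm_pos_iff.2 ha
  have hle : ∀ i, ‖(r i : K)‖ ≤ 1 := fun i => by
    have := (Valuation.mem_valuationSubring_iff _ _).1 (r i).2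
    rw [NormedField.valuation_apply] at this
    exact_mod_cast this
  have hdec : closedBall (0 : K) ‖a‖ = ⋃ i : k, closedBall (a * r i) (‖a‖ * ‖ϖ‖) := by
    ext x
    simp only [mem_closedBall, Set.mem_iUnion, dist_eq_norm, sub_zero]
    constructor
    · intro hx
      have hxa : ‖x / a‖ ≤ 1 := by rw [norm_div]; exact div_le_one_of_le₀ hx ha'.le
      let y : (NormedField.valuation (K := K)).valuationSubring := ⟨x / a, by
        rw [Valuation.mem_valuationSubring_iff, NormedField.valuation_apply]
        exact_mod_cast hxa⟩
      refine ⟨IsLocalRing.residue _ y, ?_⟩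
      have h := hmax _ ((residue_eq_iff_norm_sub_lt_one y _).1 (hr (IsLocalRing.residue _ y)).symm)
      have hx' : x - a * r (IsLocalRing.residue _ y)
          = a * ((y : K) - r (IsLocalRing.residue _ y)) := by
        simp only [y]; field_simp
      rw [hx', norm_mul]
      gcongr
    · rintro ⟨i, hi⟩
      have h1 : x = (x - a * r i) + a * r i := by ring
      rw [h1]
      refine (IsUltrametricDist.norm_add_le_max _ _).trans (max_le (hi.trans ?_) ?_)
      · exact mul_le_of_le_one_right ha'.le hϖ.le
      · rw [norm_mul]; exact mul_le_of_le_one_right ha'.le (hle i)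
  have hdisj : Pairwise (Function.onFun Disjoint
      fun i : k => closedBall (a * r i : K) (‖a‖ * ‖ϖ‖)) := by
    intro i j hij
    rw [Function.onFun, Set.disjoint_left]
    intro x hxi hxj
    apply hij
    rw [← hr i, ← hr j, residue_eq_iff_norm_sub_lt_one]
    rw [mem_closedBall, dist_eq_norm, norm_sub_rev] at hxi
    rw [mem_closedBall, dist_eq_norm] at hxj
    have h1 : a * ((r i : K) - r j) = (a * r i - x) + (x - a * r j) := by ring
    have h2 : ‖a‖ * ‖(r i : K) - r j‖ ≤ ‖a‖ * ‖ϖ‖ := by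
      rw [← norm_mul, h1]
      exact (IsUltrametricDist.norm_add_le_max _ _).trans (max_le hxi hxj)
    exact (le_of_mul_le_mul_left h2 ha').trans_lt hϖ
  rw [hdec, measure_iUnion hdisj fun i => measurableSet_closedBall, tsum_fintype]
  simp only [measure_closedBall_center μ (_ * _)]
  rw [Finset.sum_const, Finset.card_univ, nsmul_eq_mul, Nat.card_eq_fintype_card]

/-- The norm takes values in the powers of `p`, and balls have measure equal to their radius. -/
structure IsNormalized [MeasurableSpace K] (p : ℕ) (μ : Measure K) : Prop where
  one_lt : 1 < (p : ℝ)
  norm_eq_zpow : ∀ x : K, x ≠ 0 → ∃ n : ℤ, ‖x‖ = (p : ℝ) ^ n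
  measureReal_closedBall : ∀ n : ℤ, μ.real (closedBall (0 : K) ((p : ℝ) ^ n)) = (p : ℝ) ^ n

theorem isNormalized [MeasurableSpace K] [BorelSpace K] {p : ℕ} (hp : p.Prime)
    (hres : Nat.card
      (IsLocalRing.ResidueField (NormedField.valuation (K := K)).valuationSubring) = p)
    (hprime : ∃ ϖ : K, ‖ϖ‖ = (p : ℝ)⁻¹ ∧ ∀ x : K, ‖x‖ < 1 → ‖x‖ ≤ ‖ϖ‖)
    {μ : Measure K} [μ.IsAddLeftInvariant] (hμ : μ (closedBall 0 1) = 1) :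
    IsNormalized (K := K) p μ := by
  have hp1 : 1 < (p : ℝ) := by exact_mod_cast hp.one_lt
  have hp0 : 0 < (p : ℝ) := one_pos.trans hp1
  obtain ⟨ϖ, hϖ, hmax⟩ := hprime
  refine ⟨hp1, fun x hx => exists_norm_eq_zpow hp1 hϖ hmax hx, ?_⟩
  have hfin : Finite
      (IsLocalRing.ResidueField (NormedField.valuation (K := K)).valuationSubring) :=
    Nat.finite_of_card_ne_zero (by rw [hres]; exact hp.ne_zero)
  have hϖ1 : ‖ϖ‖ < 1 := by rw [hϖ]; exact inv_lt_one_of_one_lt₀ hp1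
  have hϖ0 : ϖ ≠ 0 := norm_ne_zero_iff.1 (by rw [hϖ]; positivity)
  have hstep : ∀ n : ℤ, μ.real (closedBall (0 : K) ((p : ℝ) ^ (n + 1)))
      = p * μ.real (closedBall (0 : K) ((p : ℝ) ^ n)) := fun n => by
    -- This power of `ϖ` has norm `p^(n+1)`, so consecutive balls have volume ratio `p`; `μ(𝒟) = 1`
    -- then fixes all volumes by induction in both directions.
    have h := measure_closedBall_norm_eq_card_mul μ hϖ1 hmax (a := ϖ ^ (-(n + 1)))
      (zpow_ne_zero _ hϖ0)
    have h1 : ‖ϖ ^ (-(n + 1))‖ = (p : ℝ) ^ (n + 1) := by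
      rw [norm_zpow, hϖ, inv_zpow, zpow_neg, inv_inv]
    have h2 : (p : ℝ) ^ (n + 1) * (p : ℝ)⁻¹ = (p : ℝ) ^ n := by
      rw [zpow_add_one₀ hp0.ne']; field_simp
    rw [h1, hϖ, h2, hres] at h
    simp [measureReal_def, h]
  intro n
  induction n with
  | zero => simp [measureReal_def, hμ]
  | succ n ih => rw [hstep, ih, zpow_add_one₀ hp0.ne', mul_comm]
  | pred n ih =>
    have h := hstep (-(n : ℤ) - 1)
    rw [sub_add_cancel, ih] at h
    rw [(eq_mul_inv_iff_mul_eq₀ hp0.ne').2 ((mul_comm _ _).trans h.symm), zpow_sub_one₀ hp0.ne']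

end

/-! ### Integrals of radial functions as series over shells. -/

section

variable {K : Type*} [NontriviallyNormedField K] [MeasurableSpace K]

namespace IsNormalized

variable {p : ℕ} {μ : Measure K}

theorem pos (H : IsNormalized p μ) : 0 < (p : ℝ) := one_pos.trans H.one_lt

theorem measure_closedBall_ne_top (H : IsNormalized p μ) (n : ℤ) :
    μ (closedBall (0 : K) ((p : ℝ) ^ n)) ≠ ⊤ := fun h => by
  have := H.measureReal_closedBall n
  rw [measureReal_def, h] at this
  exact (zpow_pos H.pos n).ne this

/-- The equality is only almost everywhere because the origin lies on no shell. -/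
theorem closedBall_ae_eq_shells [BorelSpace K] [NullSingletonClass μ]
    (H : IsNormalized p μ) :
    (closedBall (0 : K) 1) =ᵐ[μ] {x : K | ∃ k : ℕ, ‖x‖ = (p : ℝ) ^ (-(k : ℤ))} := by
  have h0 : ∀ᵐ x ∂μ, x ≠ 0 := by
    rw [ae_iff]; simp
  filter_upwards [h0] with x hx
  obtain ⟨n, hn⟩ := H.norm_eq_zpow x hx
  apply propext
  change x ∈ closedBall (0 : K) 1 ↔ x ∈ {x : K | ∃ k : ℕ, ‖x‖ = (p : ℝ) ^ (-(k : ℤ))}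
  rw [mem_closedBall, dist_zero_right, Set.mem_ofPred_eq, hn, zpow_le_one_iff_right₀ H.one_lt]
  constructor
  · intro h
    refine ⟨n.natAbs, ?_⟩
    congr 1; lia
  · rintro ⟨k, hk⟩
    have := zpow_right_injective₀ H.pos H.one_lt.ne' hk
    lia

theorem compl_closedBall_eq_shells (H : IsNormalized p μ) :
    (closedBall (0 : K) 1)ᶜ = {x : K | ∃ k : ℕ, ‖x‖ = (p : ℝ) ^ ((k : ℤ) + 1)} := by
  ext x
  rw [Set.mem_compl_iff, mem_closedBall, dist_zero_right, Set.mem_ofPred_eq, not_le]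
  constructor
  · intro h
    obtain ⟨n, hn⟩ := H.norm_eq_zpow x (norm_pos_iff.1 (one_pos.trans h))
    rw [hn, one_lt_zpow_iff_right₀ H.one_lt] at h
    refine ⟨(n - 1).natAbs, ?_⟩
    rw [hn]
    congr 1; lia
  · rintro ⟨k, hk⟩
    rw [hk, one_lt_zpow_iff_right₀ H.one_lt]
    lia

theorem measurableSet_sphere [BorelSpace K] (n : ℤ) : MeasurableSet {x : K | ‖x‖ = (p : ℝ) ^ n} :=
  (isClosed_eq continuous_norm continuous_const).measurableSet

theorem measure_sphere_ne_top (H : IsNormalized p μ) (n : ℤ) :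
    μ {x : K | ‖x‖ = (p : ℝ) ^ n} ≠ ⊤ := by
  refine measure_ne_top_of_subset (fun x hx => ?_) (H.measure_closedBall_ne_top n)
  have hx' : ‖x‖ = (p : ℝ) ^ n := hx
  simp [hx']

variable [BorelSpace K]

theorem measureReal_sphere (H : IsNormalized p μ) (n : ℤ) :
    μ.real {x : K | ‖x‖ = (p : ℝ) ^ n} = (p : ℝ) ^ n * (1 - 1 / p) := by
  have hp := H.pos
  have h1 : {x : K | ‖x‖ = (p : ℝ) ^ n}
      = closedBall 0 ((p : ℝ) ^ n) \ closedBall 0 ((p : ℝ) ^ (n - 1)) := by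
    ext x
    simp only [Set.mem_ofPred_eq, Set.mem_sdiff, mem_closedBall, dist_zero_right, not_le]
    constructor
    · intro h
      rw [h]
      exact ⟨le_rfl, zpow_lt_zpow_right₀ H.one_lt (by lia)⟩
    · rintro ⟨h1, h2⟩
      obtain ⟨m, hm⟩ := H.norm_eq_zpow x (norm_pos_iff.1 ((zpow_pos hp _).trans h2))
      rw [hm, zpow_le_zpow_iff_right₀ H.one_lt] at h1
      rw [hm, zpow_lt_zpow_iff_right₀ H.one_lt] at h2
      rw [hm]
      congr 1; lia
  have h3 : closedBall (0 : K) ((p : ℝ) ^ (n - 1)) ⊆ closedBall (0 : K) ((p : ℝ) ^ n) :=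
    closedBall_subset_closedBall (zpow_le_zpow_right₀ H.one_lt.le (by lia))
  rw [h1, measureReal_sdiff h3 measurableSet_closedBall
    (H.measure_closedBall_ne_top n), H.measureReal_closedBall,
    H.measureReal_closedBall, zpow_sub_one₀ hp.ne']
  ring

/-- A radial function is constant on each shell, and the shell of radius `p^n` has volume `p^n (1 -
1/p)`. Nonnegativity makes convergence of the series give integrability. -/
theorem radial_integral (H : IsNormalized p μ) {g : ℝ → ℝ} {e : ℕ → ℤ}
    (he : Function.Injective e) (hg : ∀ k, 0 ≤ g ((p : ℝ) ^ e k)) {S : ℝ}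
    (hS : HasSum (fun k => g ((p : ℝ) ^ e k) * ((p : ℝ) ^ e k * (1 - 1 / p))) S) :
    IntegrableOn (fun x : K => g ‖x‖) {x | ∃ k, ‖x‖ = (p : ℝ) ^ e k} μ ∧
      ∫ x in {x : K | ∃ k, ‖x‖ = (p : ℝ) ^ e k}, g ‖x‖ ∂μ = S := by
  have hU : {x : K | ∃ k, ‖x‖ = (p : ℝ) ^ e k} = ⋃ k, {x : K | ‖x‖ = (p : ℝ) ^ e k} := by
    ext x; simp
  have hm : ∀ k, MeasurableSet {x : K | ‖x‖ = (p : ℝ) ^ e k} := fun k => measurableSet_sphere _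
  have hcongr : ∀ k, Set.EqOn (fun x : K => g ‖x‖) (fun _ => g ((p : ℝ) ^ e k))
      {x : K | ‖x‖ = (p : ℝ) ^ e k} := fun k x hx => congrArg g hx
  have hint : ∀ k, IntegrableOn (fun x : K => g ‖x‖) {x : K | ‖x‖ = (p : ℝ) ^ e k} μ := fun k =>
    (integrableOn_const (H.measure_sphere_ne_top _)).congr_fun (hcongr k).symm (hm k)
  have hval : ∀ k, ∫ x in {x : K | ‖x‖ = (p : ℝ) ^ e k}, g ‖x‖ ∂μ
      = g ((p : ℝ) ^ e k) * ((p : ℝ) ^ e k * (1 - 1 / p)) := fun k => by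
    rw [setIntegral_congr_fun (hm k) (hcongr k), setIntegral_const, H.measureReal_sphere,
      smul_eq_mul, mul_comm]
  have hnorm : ∀ k, ∫ x in {x : K | ‖x‖ = (p : ℝ) ^ e k}, ‖g ‖x‖‖ ∂μ
      = g ((p : ℝ) ^ e k) * ((p : ℝ) ^ e k * (1 - 1 / p)) := fun k => by
    rw [← hval k]
    refine setIntegral_congr_fun (hm k) fun x hx => ?_
    have hx' : ‖x‖ = (p : ℝ) ^ e k := hx
    simp only [hx', Real.norm_of_nonneg (hg k)]
  have hI := integrableOn_iUnion_of_summable_integral_norm hint (by simp only [hnorm, hS.summable])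
  have hd : Pairwise (Function.onFun Disjoint fun k => {x : K | ‖x‖ = (p : ℝ) ^ e k}) := by
    intro i j hij
    rw [Function.onFun, Set.disjoint_left]
    intro x hi hj
    exact hij (he (zpow_right_injective₀ H.pos H.one_lt.ne' (hi.symm.trans hj)))
  rw [hU]
  refine ⟨hI, (hasSum_integral_iUnion hm hd hI).unique ?_⟩
  simpa only [hval] using hS

theorem norm_rpow_integral_closedBall [NullSingletonClass μ] (H : IsNormalized p μ) {α : ℝ}
    (hα : 0 < α) :
    IntegrableOn (fun x : K => ‖x‖ ^ (α - 1)) (closedBall 0 1) μ ∧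
      ∫ x in closedBall (0 : K) 1, ‖x‖ ^ (α - 1) ∂μ = (1 - 1 / p) / (1 - (p : ℝ) ^ (-α)) := by
  have hp := H.pos
  rw [integrableOn_congr_set_ae H.closedBall_ae_eq_shells,
    setIntegral_congr_set H.closedBall_ae_eq_shells]
  refine H.radial_integral (g := fun t => t ^ (α - 1)) (fun a b h => by simpa using h)
    (fun k => by positivity) ?_
  have h1 : ∀ k : ℕ, ((p : ℝ) ^ (-(k : ℤ))) ^ (α - 1) * ((p : ℝ) ^ (-(k : ℤ)) * (1 - 1 / p))
      = (1 - 1 / p) * ((p : ℝ) ^ (-α)) ^ k := fun k => by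
    rw [← Real.rpow_intCast, ← Real.rpow_mul hp.le, ← mul_assoc, ← Real.rpow_add hp,
      ← Real.rpow_mul_natCast hp.le, mul_comm]
    congr 2
    push_cast
    ring
  simp only [h1, div_eq_mul_inv (1 - 1 / (p : ℝ))]
  exact (hasSum_geometric_of_lt_one (by positivity)
    (Real.rpow_lt_one_of_one_lt_of_neg H.one_lt (by linarith))).mul_left _

theorem norm_rpow_integral_compl_closedBall (H : IsNormalized p μ) {α : ℝ} (hα : α < 0) :
    IntegrableOn (fun x : K => ‖x‖ ^ (α - 1)) (closedBall 0 1)ᶜ μ ∧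
      ∫ x in (closedBall (0 : K) 1)ᶜ, ‖x‖ ^ (α - 1) ∂μ
        = (1 - 1 / p) * (p : ℝ) ^ α / (1 - (p : ℝ) ^ α) := by
  have hp := H.pos
  rw [H.compl_closedBall_eq_shells]
  refine H.radial_integral (g := fun t => t ^ (α - 1)) (fun a b h => by simpa using h)
    (fun k => by positivity) ?_
  have h1 : ∀ k : ℕ, ((p : ℝ) ^ ((k : ℤ) + 1)) ^ (α - 1) * ((p : ℝ) ^ ((k : ℤ) + 1) * (1 - 1 / p))
      = (1 - 1 / p) * (p : ℝ) ^ α * ((p : ℝ) ^ α) ^ k := fun k => by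
    rw [← Real.rpow_intCast, ← Real.rpow_mul hp.le, ← mul_assoc, ← Real.rpow_add hp,
      ← Real.rpow_mul_natCast hp.le, mul_assoc, ← Real.rpow_add hp, mul_comm]
    congr 2
    push_cast
    ring
  simp only [h1]
  rw [div_eq_mul_inv]
  exact (hasSum_geometric_of_lt_one (by positivity)
    (Real.rpow_lt_one_of_one_lt_of_neg H.one_lt hα)).mul_left _

theorem one_sub_logb_norm_integral_closedBall [NullSingletonClass μ] (H : IsNormalized p μ) :
    IntegrableOn (fun x : K => 1 - Real.logb p ‖x‖) (closedBall 0 1) μ ∧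
      ∫ x in closedBall (0 : K) 1, (1 - Real.logb p ‖x‖) ∂μ = (1 - 1 / (p : ℝ))⁻¹ := by
  have hp := H.pos
  have hp1 := H.one_lt
  rw [integrableOn_congr_set_ae H.closedBall_ae_eq_shells,
    setIntegral_congr_set H.closedBall_ae_eq_shells]
  have hlog : ∀ k : ℕ, 1 - Real.logb p ((p : ℝ) ^ (-(k : ℤ))) = 1 + k := fun k => by
    rw [← Real.rpow_intCast, Real.logb_rpow hp hp1.ne']
    push_cast
    ring
  refine H.radial_integral (g := fun t => 1 - Real.logb p t) (fun a b h => by simpa using h)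
    (fun k => by simp only [hlog]; positivity) ?_
  have hlt : (p : ℝ)⁻¹ < 1 := inv_lt_one_of_one_lt₀ hp1
  -- The integrand is `1 + k` on the shell of radius `p^(-k)`, whence the series of `r^k` and `k
  -- r^k` with `r = 1/p`.
  have h := ((hasSum_geometric_of_lt_one (by positivity) hlt).add
    (hasSum_coe_mul_geometric_of_norm_lt_one (r := (p : ℝ)⁻¹)
      (by rwa [Real.norm_of_nonneg (by positivity)]))).mul_right (1 - 1 / (p : ℝ))
  have hne : (1 - (p : ℝ)⁻¹) ≠ 0 := (sub_pos.2 hlt).ne'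
  have hfun : ∀ k : ℕ, (1 - Real.logb p ((p : ℝ) ^ (-(k : ℤ))))
      * ((p : ℝ) ^ (-(k : ℤ)) * (1 - 1 / p))
      = ((p : ℝ)⁻¹ ^ k + k * (p : ℝ)⁻¹ ^ k) * (1 - 1 / (p : ℝ)) := fun k => by
    rw [hlog, zpow_neg, zpow_natCast, inv_pow]
    ring
  have hval : (1 - 1 / (p : ℝ))⁻¹
      = ((1 - (p : ℝ)⁻¹)⁻¹ + (p : ℝ)⁻¹ / (1 - (p : ℝ)⁻¹) ^ 2) * (1 - 1 / (p : ℝ)) := by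
    rw [one_div]
    generalize (p : ℝ)⁻¹ = r at hne
    field_simp
    ring
  rw [hval]
  simpa only [hfun] using h

end IsNormalized

end

/-! ### The layer functional and its kernel. -/

section

variable {K : Type*} [NontriviallyNormedField K] [MeasurableSpace K] {p : ℕ} {μ : Measure K}

/-- The value of `κ_θ` on functions that are constant on the ball of radius `p ^ (-N)`. -/
noncomputable def layerFunctional (p : ℕ) (μ : Measure K) (θ : ℝ) (N : ℕ) (ψ : K → ℂ) : ℂ :=
  (((p : ℝ) ^ θ) ^ N : ℝ) * ψ 0 + ∑ n ∈ Finset.range N,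
    (((1 - (p : ℝ) ^ θ) * ((p : ℝ) ^ (θ + 1)) ^ n : ℝ) : ℂ) *
      ∫ x in closedBall (0 : K) ((p : ℝ) ^ (-(n : ℤ))), ψ x ∂μ

namespace IsNormalized

/-- A point of norm `p^(-m)` lies in the `n`-th ball exactly when `n ≤ m`; since `m < N`, truncating
at `N` loses no layer. -/
theorem exists_norm_eq_and_layer_sum_eq (H : IsNormalized p μ) {N : ℕ} {x : K}
    (hN : (p : ℝ) ^ (-(N : ℤ)) < ‖x‖) (h1 : ‖x‖ ≤ 1) :
    ∃ m : ℕ, ‖x‖ = (p : ℝ) ^ (-(m : ℤ)) ∧ ∀ c : ℕ → ℝ,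
      (∑ n ∈ Finset.range N, if ‖x‖ ≤ (p : ℝ) ^ (-(n : ℤ)) then c n else 0)
        = ∑ n ∈ Finset.range (m + 1), c n := by
  obtain ⟨n, hn⟩ := H.norm_eq_zpow x (norm_pos_iff.1 ((zpow_pos H.pos _).trans hN))
  have h2 := h1
  rw [hn, zpow_le_one_iff_right₀ H.one_lt] at h2
  have h3 := hN
  rw [hn, zpow_lt_zpow_iff_right₀ H.one_lt] at h3
  refine ⟨n.natAbs, by rw [hn]; congr 1; lia, fun c => ?_⟩
  rw [← Finset.sum_filter]
  refine Finset.sum_congr ?_ fun _ _ => rfl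
  ext i
  rw [Finset.mem_filter, Finset.mem_range, Finset.mem_range, hn,
    zpow_le_zpow_iff_right₀ H.one_lt]
  lia

variable [BorelSpace K] [ProperSpace K] [IsFiniteMeasureOnCompacts μ]

/-- Since `ψ - ψ(0)` vanishes for `|x| ≤ p^(-N)`, the kernel matters only away from the origin,
where it is a finite combination of indicators of balls. Its own integrability is not needed. -/
theorem integral_sub_mul_kernel (H : IsNormalized p μ) {N : ℕ} {ψ : K → ℂ} (hc : Continuous ψ)
    (hψ : ∀ x, ‖x‖ ≤ (p : ℝ) ^ (-(N : ℤ)) → ψ x = ψ 0) {k : K → ℝ} {c : ℕ → ℝ}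
    (hk : ∀ x : K, (p : ℝ) ^ (-(N : ℤ)) < ‖x‖ → ‖x‖ ≤ 1 →
      k x = ∑ n ∈ Finset.range N, if ‖x‖ ≤ (p : ℝ) ^ (-(n : ℤ)) then c n else 0) :
    IntegrableOn (fun x => (ψ x - ψ 0) * (k x : ℂ)) (closedBall 0 1) μ ∧
      ∫ x in closedBall (0 : K) 1, (ψ x - ψ 0) * (k x : ℂ) ∂μ
        = ∑ n ∈ Finset.range N, (c n : ℂ) *
          ((∫ x in closedBall (0 : K) ((p : ℝ) ^ (-(n : ℤ))), ψ x ∂μ)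
            - ((p : ℝ) ^ (-(n : ℤ)) : ℝ) * ψ 0) := by
  set B : ℕ → Set K := fun n => closedBall (0 : K) ((p : ℝ) ^ (-(n : ℤ))) with hB
  have hint : ∀ n, IntegrableOn ψ (B n) μ := fun n =>
    hc.continuousOn.integrableOn_compact (isCompact_closedBall _ _)
  have hconst : ∀ n, IntegrableOn (fun _ => ψ 0) (B n) μ := fun n =>
    continuousOn_const.integrableOn_compact (isCompact_closedBall _ _)
  have hsub : ∀ n, B n ⊆ closedBall 0 1 := fun n => closedBall_subset_closedBall
    (zpow_le_one_of_nonpos₀ H.one_lt.le (by lia))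
  have heq : Set.EqOn (fun x => (ψ x - ψ 0) * (k x : ℂ))
      (fun x => ∑ n ∈ Finset.range N, (c n : ℂ) * (B n).indicator (fun x => ψ x - ψ 0) x)
      (closedBall 0 1) := by
    intro x hx
    have hx1 : ‖x‖ ≤ 1 := by simpa using hx
    rcases le_or_gt ‖x‖ ((p : ℝ) ^ (-(N : ℤ))) with h | h
    · have h0 : ∀ n, (B n).indicator (fun x => ψ x - ψ 0) x = 0 := fun n =>
        Set.indicator_apply_eq_zero.2 fun _ => sub_eq_zero.2 (hψ x h)
      simp [h0, hψ x h]
    · simp only [hk x h hx1, Complex.ofReal_sum, Finset.mul_sum]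
      refine Finset.sum_congr rfl fun n _ => ?_
      by_cases hn : ‖x‖ ≤ (p : ℝ) ^ (-(n : ℤ))
      · rw [if_pos hn, Set.indicator_of_mem (by simpa [hB] using hn), mul_comm]
      · rw [if_neg hn, Set.indicator_of_notMem (by simpa [hB] using hn)]
        simp
  have hterm : ∀ n, Integrable
      (fun x => (c n : ℂ) * (B n).indicator (fun x => ψ x - ψ 0) x) μ := fun n =>
    (((hint n).sub (hconst n)).integrable_indicator measurableSet_closedBall).const_mul _
  refine ⟨(integrable_finsetSum _ fun n _ => hterm n).integrableOn.congr_fun heq.symm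
    measurableSet_closedBall, ?_⟩
  rw [setIntegral_congr_fun measurableSet_closedBall heq,
    integral_finsetSum _ fun n _ => (hterm n).integrableOn]
  refine Finset.sum_congr rfl fun n _ => ?_
  rw [integral_const_mul, setIntegral_indicator measurableSet_closedBall,
    Set.inter_eq_self_of_subset_right (hsub n), integral_sub (hint n) (hconst n),
    setIntegral_const, H.measureReal_closedBall, Complex.real_smul]

theorem layerFunctional_eq_of_kernel (H : IsNormalized p μ) (θ : ℝ) {N : ℕ} {ψ : K → ℂ}
    (hc : Continuous ψ) (hψ : ∀ x, ‖x‖ ≤ (p : ℝ) ^ (-(N : ℤ)) → ψ x = ψ 0) {k : K → ℝ}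
    (hk : ∀ (x : K) (m : ℕ), ‖x‖ = (p : ℝ) ^ (-(m : ℤ)) →
      k x = ∑ n ∈ Finset.range (m + 1), (1 - (p : ℝ) ^ θ) * ((p : ℝ) ^ (θ + 1)) ^ n) :
    IntegrableOn (fun x => (ψ x - ψ 0) * (k x : ℂ)) (closedBall 0 1) μ ∧
      layerFunctional p μ θ N ψ
        = ∫ x in closedBall (0 : K) 1, (ψ x - ψ 0) * (k x : ℂ) ∂μ + ψ 0 := by
  have hp := H.pos
  obtain ⟨hI, hv⟩ := H.integral_sub_mul_kernel hc hψ (k := k)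
    (c := fun n => (1 - (p : ℝ) ^ θ) * ((p : ℝ) ^ (θ + 1)) ^ n) fun x h h1 => by
      obtain ⟨m, hm, hsum⟩ := H.exists_norm_eq_and_layer_sum_eq h h1
      rw [hsum, hk x m hm]
  refine ⟨hI, ?_⟩
  -- Each coefficient times the volume of its ball is `(1 - t) t^n` with `t = p^θ`. The sum
  -- telescopes and complements the term `t^N ψ(0)`, leaving `ψ(0)` with coefficient `1`.
  have htel : ∑ n ∈ Finset.range N, (1 - (p : ℝ) ^ θ) * ((p : ℝ) ^ (θ + 1)) ^ n
      * (p : ℝ) ^ (-(n : ℤ)) = 1 - ((p : ℝ) ^ θ) ^ N := by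
    rw [← mul_neg_geom_sum, Finset.mul_sum]
    refine Finset.sum_congr rfl fun n _ => ?_
    rw [Real.rpow_add_one hp.ne', mul_pow, zpow_neg, zpow_natCast]
    field_simp
  have htel' := congrArg (fun r : ℝ => (r : ℂ)) htel
  simp only [Complex.ofReal_sum, Complex.ofReal_mul _ ((p : ℝ) ^ (-(_ : ℤ)))] at htel'
  rw [hv, layerFunctional]
  simp only [mul_sub, Finset.sum_sub_distrib, ← mul_assoc]
  rw [← Finset.sum_mul, htel']
  push_cast
  ring

end IsNormalized

end

/-! ### Identification of `κ_θ` with the layer functional. -/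

section

variable {K : Type*} [NontriviallyNormedField K]

theorem integral_mul_eq_integral_sub_mul_add [MeasurableSpace K] {μ : Measure K} {s : Set K}
    (ψ k : K → ℂ)
    (h1 : IntegrableOn (fun x => (ψ x - ψ 0) * k x) s μ) (h2 : IntegrableOn k s μ) :
    ∫ x in s, ψ x * k x ∂μ = ∫ x in s, (ψ x - ψ 0) * k x ∂μ + ψ 0 * ∫ x in s, k x ∂μ := by
  rw [← integral_const_mul, ← integral_add h1 (h2.const_mul _)]
  congr 1
  ext x
  ring

variable [IsUltrametricDist K]

theorem cutoff_mul_eq_indicator (ψ : Schwartz K) (f : K → ℂ) :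
    (fun x => (cutoff ψ).1 x * f x) = (closedBall (0 : K) 1).indicator fun x => ψ.1 x * f x := by
  ext x
  by_cases hx : x ∈ closedBall (0 : K) 1 <;> simp [cutoff, unitBallIndicator, hx]

theorem cutoff_apply_of_mem (ψ : Schwartz K) {x : K} (hx : x ∈ closedBall (0 : K) 1) :
    (cutoff ψ).1 x = ψ.1 x := by
  simp [cutoff, unitBallIndicator, hx]

theorem cutoff_apply_of_notMem (ψ : Schwartz K) {x : K} (hx : x ∉ closedBall (0 : K) 1) :
    (cutoff ψ).1 x = 0 := by
  simp [cutoff, unitBallIndicator, hx]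

variable [MeasurableSpace K] [BorelSpace K] {p : ℕ} {μ : Measure K}

theorem integral_cutoff_mul (ψ : Schwartz K) (f : K → ℂ) :
    ∫ x, (cutoff ψ).1 x * f x ∂μ = ∫ x in closedBall (0 : K) 1, ψ.1 x * f x ∂μ := by
  rw [cutoff_mul_eq_indicator, integral_indicator measurableSet_closedBall]

namespace IsNormalized

variable [NullSingletonClass μ]

/-- For `α > 0` the constant is the integral of `|x|^(α-1)` over the unit ball. For `α < 0` it is
minus the integral over the complement, where the cutoff vanishes but the subtracted `ψ(0)` remains.
Both are the same rational expression in `p^α`. -/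
theorem homogeneousDistribution_cutoff (H : IsNormalized p μ) {α : ℝ} (hα : α ≠ 0)
    (ψ : Schwartz K)
    (hI : IntegrableOn (fun x => (ψ.1 x - ψ.1 0) * ((‖x‖ ^ (α - 1) : ℝ) : ℂ))
      (closedBall 0 1) μ) :
    homogeneousDistribution μ α (cutoff ψ)
      = ∫ x in closedBall (0 : K) 1, (ψ.1 x - ψ.1 0) * ((‖x‖ ^ (α - 1) : ℝ) : ℂ) ∂μ
        + ψ.1 0 * (((1 - 1 / p) / (1 - (p : ℝ) ^ (-α)) : ℝ) : ℂ) := by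
  have hp := H.pos
  rcases hα.lt_or_gt with h | h
  · obtain ⟨h1, h2⟩ := H.norm_rpow_integral_compl_closedBall h
    have h0 : (cutoff ψ).1 0 = ψ.1 0 := cutoff_apply_of_mem ψ (by simp)
    have hin : Set.EqOn (fun x => ((cutoff ψ).1 x - (cutoff ψ).1 0) * ((‖x‖ ^ (α - 1) : ℝ) : ℂ))
        (fun x => (ψ.1 x - ψ.1 0) * ((‖x‖ ^ (α - 1) : ℝ) : ℂ)) (closedBall 0 1) := fun x hx => by
      simp only [h0, cutoff_apply_of_mem ψ hx]
    have hout : Set.EqOn (fun x => ((cutoff ψ).1 x - (cutoff ψ).1 0) * ((‖x‖ ^ (α - 1) : ℝ) : ℂ))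
        (fun x => -ψ.1 0 * ((‖x‖ ^ (α - 1) : ℝ) : ℂ)) (closedBall 0 1)ᶜ := fun x hx => by
      simp only [h0, cutoff_apply_of_notMem ψ hx, zero_sub]
    have hm : MeasurableSet (closedBall (0 : K) 1) := measurableSet_closedBall
    have hIin := hI.congr_fun hin.symm hm
    have hIout : IntegrableOn
        (fun x => ((cutoff ψ).1 x - (cutoff ψ).1 0) * ((‖x‖ ^ (α - 1) : ℝ) : ℂ))
        (closedBall 0 1)ᶜ μ :=
      IntegrableOn.congr_fun (h1.ofReal.const_mul _) hout.symm hm.compl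
    have hInt := (integrableOn_univ (μ := μ)).1
      (Set.union_compl_self (closedBall (0 : K) 1) ▸ hIin.union hIout)
    rw [homogeneousDistribution, if_neg h.not_gt, ← integral_add_compl hm hInt,
      setIntegral_congr_fun hm hin, setIntegral_congr_fun hm.compl hout, integral_const_mul,
      integral_complex_ofReal, h2, neg_mul, ← mul_neg, ← Complex.ofReal_neg]
    congr 3
    have h3 : (p : ℝ) ^ α ≠ 0 := (Real.rpow_pos_of_pos hp _).ne'
    have h4 : 1 - (p : ℝ) ^ α ≠ 0 :=
      (sub_pos.2 (Real.rpow_lt_one_of_one_lt_of_neg H.one_lt h)).ne'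
    have h5 : (p : ℝ) ^ α - 1 ≠ 0 := by rwa [← neg_sub, neg_ne_zero]
    rw [Real.rpow_neg hp.le]
    generalize (p : ℝ) ^ α = t at *
    field_simp
    ring
  · obtain ⟨h1, h2⟩ := H.norm_rpow_integral_closedBall h
    rw [homogeneousDistribution, if_pos h, integral_cutoff_mul,
      integral_mul_eq_integral_sub_mul_add _ _ hI h1.ofReal, integral_complex_ofReal, h2]

variable [ProperSpace K] [IsFiniteMeasureOnCompacts μ]

theorem kappa_neg_one_eq_layerFunctional (H : IsNormalized p μ) {N : ℕ} (ψ : Schwartz K)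
    (hψ : ∀ x, ‖x‖ ≤ (p : ℝ) ^ (-(N : ℤ)) → ψ.1 x = ψ.1 0) :
    kappa p μ (-1) ψ = layerFunctional p μ (-1) N ψ.1 := by
  have hp := H.pos
  have hp1 : 1 - 1 / (p : ℝ) ≠ 0 := by
    rw [one_div]; exact (sub_pos.2 (inv_lt_one_of_one_lt₀ H.one_lt)).ne'
  obtain ⟨h1, h2⟩ := H.one_sub_logb_norm_integral_closedBall
  -- For `θ = -1` the geometric ratio is `1`, so the kernel at `|x| = p^(-m)` is `(1 - 1/p)(m + 1)`.
  obtain ⟨hI, hv⟩ := H.layerFunctional_eq_of_kernel (-1) ψ.2.1.continuous hψ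
    (k := fun x => (1 - 1 / (p : ℝ)) * (1 - Real.logb p ‖x‖)) fun x m hm => by
      rw [hm, ← Real.rpow_intCast, Real.logb_rpow hp H.one_lt.ne', neg_add_cancel,
        Real.rpow_zero, Real.rpow_neg_one]
      simp
      ring
  have hk : ∫ x in closedBall (0 : K) 1, (((1 - 1 / (p : ℝ)) * (1 - Real.logb p ‖x‖) : ℝ) : ℂ) ∂μ
      = 1 := by
    rw [integral_complex_ofReal, integral_const_mul, h2, mul_inv_cancel₀ hp1, Complex.ofReal_one]
  have hcut : (fun x => (((1 - 1 / (p : ℝ)) * (1 - Real.logb p ‖x‖) : ℝ) : ℂ)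
      * unitBallIndicator K x * ψ.1 x)
      = fun x => (cutoff ψ).1 x * (((1 - 1 / (p : ℝ)) * (1 - Real.logb p ‖x‖) : ℝ) : ℂ) := by
    ext x
    simp only [cutoff]
    ring
  rw [hv, kappa, if_neg (by norm_num), if_pos rfl, ofFunction, hcut, integral_cutoff_mul,
    integral_mul_eq_integral_sub_mul_add _ _ hI (h1.const_mul _).ofReal, hk, mul_one]

theorem kappa_eq_layerFunctional_of_ne (H : IsNormalized p μ) {θ : ℝ} (h0 : θ ≠ 0) (h1 : θ ≠ -1)
    {N : ℕ} (ψ : Schwartz K) (hψ : ∀ x, ‖x‖ ≤ (p : ℝ) ^ (-(N : ℤ)) → ψ.1 x = ψ.1 0) :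
    kappa p μ θ ψ = layerFunctional p μ θ N ψ.1 := by
  have hp := H.pos
  have hq : (p : ℝ) ^ (θ + 1) = p * (p : ℝ) ^ θ := by rw [Real.rpow_add_one hp.ne', mul_comm]
  have hne : ∀ {β : ℝ}, β ≠ 0 → (p : ℝ) ^ β ≠ 1 := fun hβ h => hβ
    ((Real.rpow_right_inj hp H.one_lt.ne').1 (h.trans (Real.rpow_zero _).symm))
  have hθ := hne h0
  have hθ1 := hne (β := θ + 1) (fun h => h1 (by linarith))
  have hθ0 : (p : ℝ) ^ θ ≠ 0 := (Real.rpow_pos_of_pos hp _).ne'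
  have hinv : (p : ℝ) ^ (-θ - 1) = ((p : ℝ) ^ (θ + 1))⁻¹ := by
    rw [← Real.rpow_neg hp.le]; congr 1; ring
  have hinv1 : ((p : ℝ) ^ (θ + 1))⁻¹ ≠ 1 := by rwa [ne_eq, inv_eq_one]
  set a : ℝ := (1 - (p : ℝ) ^ θ) / (1 - (p : ℝ) ^ (-θ - 1)) with ha
  set b : ℝ := (1 - (p : ℝ) ^ θ) / (1 - (p : ℝ) ^ (θ + 1)) with hb
  have ha0 : a ≠ 0 := by
    rw [ha, hinv]; exact div_ne_zero (sub_ne_zero.2 hθ.symm) (sub_ne_zero.2 hinv1.symm)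
  -- With `q = p^(θ+1) ≠ 1`, summing the geometric series up to `q^m = |x|^(-θ-1)` produces exactly
  -- the constants `a` and `b`.
  obtain ⟨hI, hv⟩ := H.layerFunctional_eq_of_kernel θ ψ.2.1.continuous hψ
    (k := fun x => a * ‖x‖ ^ (-θ - 1) + b) fun x m hm => by
      have h3 : ((p : ℝ) ^ (-(m : ℤ))) ^ (-θ - 1) = ((p : ℝ) ^ (θ + 1)) ^ m := by
        rw [← Real.rpow_intCast, ← Real.rpow_mul hp.le, ← Real.rpow_mul_natCast hp.le]
        congr 1
        push_cast
        ring
      have h4 : (p : ℝ) ^ (θ + 1) - 1 ≠ 0 := sub_ne_zero.2 hθ1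
      have h5 : 1 - (p : ℝ) ^ (θ + 1) ≠ 0 := sub_ne_zero.2 hθ1.symm
      have h6 : (p : ℝ) ^ (θ + 1) ≠ 0 := (Real.rpow_pos_of_pos hp _).ne'
      rw [hm, h3, ← Finset.mul_sum, geom_sum_eq hθ1, ha, hb, hinv]
      generalize (p : ℝ) ^ (θ + 1) = q at *
      have h7 : 1 - q = -(q - 1) := by ring
      rw [h7]
      field_simp
      ring
  have hsub : IntegrableOn (fun x => ψ.1 x - ψ.1 0) (closedBall 0 1) μ :=
    (ψ.2.1.continuous.sub continuous_const).continuousOn.integrableOn_compact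
      (isCompact_closedBall _ _)
  -- Solving the kernel for `|x|^(-θ-1)`, possible as `a ≠ 0`, transfers integrability from the
  -- layer kernel.
  have hpi : (fun x : K => (ψ.1 x - ψ.1 0) * ((‖x‖ ^ (-θ - 1) : ℝ) : ℂ))
      = fun x => (a : ℂ)⁻¹ * ((ψ.1 x - ψ.1 0) * ((a * ‖x‖ ^ (-θ - 1) + b : ℝ) : ℂ)
        - b * (ψ.1 x - ψ.1 0)) := by
    have ha0' : (a : ℂ) ≠ 0 := Complex.ofReal_ne_zero.2 ha0
    ext x
    push_cast
    field_simp
    ring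
  have hIpi : IntegrableOn (fun x : K => (ψ.1 x - ψ.1 0) * ((‖x‖ ^ (-θ - 1) : ℝ) : ℂ))
      (closedBall 0 1) μ := by
    rw [hpi]
    exact (hI.sub (hsub.const_mul _)).const_mul _
  have hone : ofFunction μ (fun _ => 1) (cutoff ψ)
      = ∫ x in closedBall (0 : K) 1, (ψ.1 x - ψ.1 0) ∂μ + ψ.1 0 := by
    have h := integral_cutoff_mul (μ := μ) ψ fun _ => 1
    have hball := H.measureReal_closedBall 0
    rw [zpow_zero] at hball
    have hcst : IntegrableOn (fun _ => ψ.1 0) (closedBall (0 : K) 1) μ :=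
      continuousOn_const.integrableOn_compact (isCompact_closedBall _ _)
    simp only [mul_one] at h
    simp only [ofFunction, one_mul, h]
    have h' : ∫ x in closedBall (0 : K) 1, ψ.1 x ∂μ
        = ∫ x in closedBall (0 : K) 1, ((ψ.1 x - ψ.1 0) + ψ.1 0) ∂μ := by simp
    rw [h', integral_add hsub hcst, setIntegral_const, hball, one_smul]
  -- The regularized mass of the kernel on the unit ball is `1`, matching the coefficient of `ψ(0)`
  -- on the layer side.
  have hab : a * ((1 - 1 / p) / (1 - (p : ℝ) ^ θ)) + b = 1 := by
    have h3 : 1 - (p : ℝ) ^ θ ≠ 0 := sub_ne_zero.2 hθ.symm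
    have h4 : (p : ℝ) * (p : ℝ) ^ θ - 1 ≠ 0 := by rw [← hq]; exact sub_ne_zero.2 hθ1
    rw [ha, hb, hinv, hq]
    generalize (p : ℝ) ^ θ = t at *
    have h7 : 1 - (p : ℝ) * t = -(p * t - 1) := by ring
    have h8 : 1 - ((p : ℝ) * t)⁻¹ = (p * t - 1) / (p * t) := by field_simp
    rw [h7, h8]
    obtain ⟨d, hd⟩ : ∃ d, (p : ℝ) * t - 1 = d := ⟨_, rfl⟩
    rw [hd] at h4 ⊢
    field_simp
    linear_combination hd
  have hab' : (a : ℂ) * (((1 - 1 / p) / (1 - (p : ℝ) ^ θ) : ℝ) : ℂ) + b = 1 := by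
    rw [← Complex.ofReal_mul, ← Complex.ofReal_add, hab, Complex.ofReal_one]
  have ha0' : (a : ℂ) ≠ 0 := Complex.ofReal_ne_zero.2 ha0
  rw [hv, kappa, if_neg h0, if_neg h1, H.homogeneousDistribution_cutoff (neg_ne_zero.2 h0) ψ hIpi,
    hone, hpi, integral_const_mul, integral_sub hI (hsub.const_mul _), integral_const_mul,
    ← ha, ← hb, neg_neg, mul_add, mul_inv_cancel_left₀ ha0']
  linear_combination ψ.1 0 * hab'

/-- Any sufficiently large `N` is allowed, so several test functions can share one. For `θ = 0` all
layer coefficients vanish and only `ψ(0)` is left. -/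
theorem kappa_eq_layerFunctional (H : IsNormalized p μ) (θ : ℝ) {N : ℕ} (ψ : Schwartz K)
    (hψ : ∀ x, ‖x‖ ≤ (p : ℝ) ^ (-(N : ℤ)) → ψ.1 x = ψ.1 0) :
    kappa p μ θ ψ = layerFunctional p μ θ N ψ.1 := by
  by_cases h0 : θ = 0
  · simp [h0, kappa, layerFunctional]
  by_cases h1 : θ = -1
  · rw [h1, H.kappa_neg_one_eq_layerFunctional ψ hψ]
  exact H.kappa_eq_layerFunctional_of_ne h0 h1 ψ hψ

end IsNormalized

end

/-! ### Fourier transform, temperedness and the Sobolev bound. -/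

section

/-- The factor `2^s` comes from `1 + r² ≤ 2r²` when `s ≥ 0`; for `s ≤ 0` the factor `1` suffices.
The exponent is shaped as `α - 1` to fit the integral of `‖x‖^(α-1)` outside the unit ball. -/
theorem norm_rpow_mul_sq_le {r : ℝ} (hr : 1 < r) (s θ : ℝ) :
    (1 + r ^ 2) ^ s * (r ^ θ) ^ 2 ≤ max 1 (2 ^ s) * r ^ ((2 * s + 2 * θ + 1) - 1) := by
  have hr0 : 0 < r := one_pos.trans hr
  have h1 : (r ^ 2) ^ s * (r ^ θ) ^ 2 = r ^ ((2 * s + 2 * θ + 1) - 1) := by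
    rw [← Real.rpow_natCast, ← Real.rpow_natCast, ← Real.rpow_mul hr0.le,
      ← Real.rpow_mul hr0.le, ← Real.rpow_add hr0]
    congr 1
    push_cast
    ring
  have h2 : (1 + r ^ 2) ^ s ≤ max 1 (2 ^ s) * (r ^ 2) ^ s := by
    rcases le_total 0 s with hs | hs
    · calc (1 + r ^ 2) ^ s ≤ (2 * r ^ 2) ^ s := by
            refine Real.rpow_le_rpow (by positivity) ?_ hs
            nlinarith
        _ = 2 ^ s * (r ^ 2) ^ s := Real.mul_rpow (by norm_num) (by positivity)
        _ ≤ _ := by gcongr; exact le_max_right _ _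
    · calc (1 + r ^ 2) ^ s ≤ (r ^ 2) ^ s :=
            Real.rpow_le_rpow_of_nonpos (by positivity) (by linarith) hs
        _ ≤ _ := le_mul_of_one_le_left (by positivity) (le_max_left _ _)
  rw [← h1, ← mul_assoc]
  gcongr

theorem pow_eq_pow_add_sum_layers (t : ℝ) {m N : ℕ} (h : m ≤ N) :
    t ^ m = t ^ N + ∑ n ∈ Finset.range N, if m ≤ n then (1 - t) * t ^ n else 0 := by
  induction N, h using Nat.le_induction with
  | base =>
    rw [Finset.sum_eq_zero fun n hn => if_neg (by simpa using hn), add_zero]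
  | succ N hN ih =>
    rw [Finset.sum_range_succ, if_pos hN, ih]
    ring

variable {K : Type*} [NontriviallyNormedField K]

/-- Orthogonality: on the dual ball the character is trivial; elsewhere a translation preserving the
domain multiplies the integral by some `χ(y) ≠ 1`, so it vanishes. -/
theorem integral_charFun_closedBall [MeasurableSpace K] [BorelSpace K] [IsUltrametricDist K]
    {p : ℕ} {μ : Measure K} [μ.IsAddRightInvariant] (H : IsNormalized p μ)
    (χ : StandardCharacter K p) (n : ℕ) (x : K) :
    ∫ ξ in closedBall (0 : K) ((p : ℝ) ^ (-(n : ℤ))), (χ.char (-(ξ * x)) : ℂ) ∂μ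
      = (closedBall (0 : K) ((p : ℝ) ^ (n : ℤ))).indicator
          (fun _ => (((p : ℝ) ^ (-(n : ℤ)) : ℝ) : ℂ)) x := by
  have hp := H.pos
  by_cases hx : x ∈ closedBall (0 : K) ((p : ℝ) ^ (n : ℤ))
  · rw [Set.indicator_of_mem hx]
    rw [mem_closedBall, dist_zero_right] at hx
    have h1 : Set.EqOn (fun ξ : K => (χ.char (-(ξ * x)) : ℂ)) (fun _ => 1)
        (closedBall (0 : K) ((p : ℝ) ^ (-(n : ℤ)))) := by
      intro ξ hξ
      rw [mem_closedBall, dist_zero_right] at hξ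
      have : ‖-(ξ * x)‖ ≤ 1 := by
        rw [norm_neg, norm_mul]
        calc ‖ξ‖ * ‖x‖ ≤ (p : ℝ) ^ (-(n : ℤ)) * (p : ℝ) ^ (n : ℤ) := by gcongr
          _ = 1 := by rw [← zpow_add₀ hp.ne']; simp
      simp [χ.trivial_on_integers _ this]
    rw [setIntegral_congr_fun measurableSet_closedBall h1, setIntegral_const,
      H.measureReal_closedBall, Complex.real_smul, mul_one]
  · rw [Set.indicator_of_notMem hx]
    rw [mem_closedBall, dist_zero_right, not_le] at hx
    have hx0 : x ≠ 0 := norm_pos_iff.1 ((zpow_pos hp _).trans hx)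
    obtain ⟨m, hm⟩ := H.norm_eq_zpow x hx0
    have hmn := hx
    rw [hm, zpow_lt_zpow_iff_right₀ H.one_lt] at hmn
    obtain ⟨y, hy1, hy2⟩ := χ.nontrivial_on_inverse_prime
    -- Here `‖y‖ ≤ p` and, the norm being discrete, `‖x‖ ≥ p^(n+1)`.
    have hh : ‖y / x‖ ≤ (p : ℝ) ^ (-(n : ℤ)) := by
      rw [norm_div, hm, div_le_iff₀ (zpow_pos hp _), ← zpow_add₀ hp.ne']
      calc ‖y‖ ≤ (p : ℝ) ^ (1 : ℤ) := by simpa using hy1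
        _ ≤ _ := zpow_le_zpow_right₀ H.one_lt.le (by lia)
    rw [← integral_indicator measurableSet_closedBall]
    set f := (closedBall (0 : K) ((p : ℝ) ^ (-(n : ℤ)))).indicator
      fun ξ : K => (χ.char (-(ξ * x)) : ℂ) with hf
    have hshift : ∀ ξ, f (ξ + -(y / x)) = (χ.char y : ℂ) * f ξ := by
      intro ξ
      have hiff : ξ + -(y / x) ∈ closedBall (0 : K) ((p : ℝ) ^ (-(n : ℤ)))
          ↔ ξ ∈ closedBall (0 : K) ((p : ℝ) ^ (-(n : ℤ))) := by
        simp only [mem_closedBall, dist_zero_right]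
        constructor
        · intro h
          have := IsUltrametricDist.norm_add_le_max (ξ + -(y / x)) (y / x)
          rw [neg_add_cancel_right] at this
          exact this.trans (max_le h hh)
        · intro h
          exact (IsUltrametricDist.norm_add_le_max _ _).trans (max_le h (by rwa [norm_neg]))
      by_cases h : ξ ∈ closedBall (0 : K) ((p : ℝ) ^ (-(n : ℤ)))
      · rw [hf, Set.indicator_of_mem h, Set.indicator_of_mem (hiff.2 h)]
        have h3 : -((ξ + -(y / x)) * x) = y + -(ξ * x) := by
          field_simp
          ring
        rw [h3, AddChar.map_add_eq_mul, Circle.coe_mul]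
      · rw [hf, Set.indicator_of_notMem h, Set.indicator_of_notMem (fun h' => h (hiff.1 h')),
          mul_zero]
    have key : ∫ ξ, f ξ ∂μ = (χ.char y : ℂ) * ∫ ξ, f ξ ∂μ := by
      conv_lhs => rw [← integral_add_right_eq_self _ (-(y / x))]
      simp only [hshift, integral_const_mul]
    have hy' : (χ.char y : ℂ) ≠ 1 := fun h => hy2 (Circle.ext (by simpa using h))
    by_contra hne
    exact hy' (mul_right_cancel₀ hne (by rw [one_mul]; exact key.symm))

theorem continuous_max_one_norm_rpow (θ : ℝ) : Continuous fun x : K => max 1 ‖x‖ ^ θ :=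
  (continuous_const.max continuous_norm).rpow_const fun _ =>
    Or.inl (one_pos.trans_le (le_max_left _ _)).ne'

variable [MeasurableSpace K] {p : ℕ} {μ : Measure K}

theorem Schwartz.integrable [BorelSpace K] [IsFiniteMeasureOnCompacts μ] (φ : Schwartz K) :
    Integrable φ.1 μ :=
  φ.2.1.continuous.integrable_of_hasCompactSupport φ.2.2

/-- Fubini, with the integrand dominated by `|φ|` over a ball of finite volume, reduces this to
orthogonality. -/
theorem integral_fourierIntegral_closedBall [ProperSpace K] [BorelSpace K] [IsUltrametricDist K] [μ.IsAddHaarMeasure]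
    (H : IsNormalized p μ)
    (χ : StandardCharacter K p) (n : ℕ) (φ : Schwartz K) :
    ∫ ξ in closedBall (0 : K) ((p : ℝ) ^ (-(n : ℤ))), fourierIntegral χ μ φ.1 ξ ∂μ
      = (((p : ℝ) ^ (-(n : ℤ)) : ℝ) : ℂ) * ∫ x in closedBall (0 : K) ((p : ℝ) ^ (n : ℤ)), φ.1 x ∂μ
      := by
  set B := closedBall (0 : K) ((p : ℝ) ^ (-(n : ℤ))) with hB
  have hfin : IsFiniteMeasure (μ.restrict B) :=
    ⟨by rw [Measure.restrict_apply_univ]; exact (isCompact_closedBall _ _).measure_lt_top⟩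
  have hint : Integrable (Function.uncurry fun ξ x : K => φ.1 x * (χ.char (-(ξ * x)) : ℂ))
      ((μ.restrict B).prod μ) := by
    have h1 : Integrable (fun z : K × K => (1 : ℂ) * φ.1 z.2) ((μ.restrict B).prod μ) :=
      (integrable_const (1 : ℂ)).mul_prod (Schwartz.integrable φ)
    simp only [one_mul] at h1
    refine h1.mul_bdd (c := 1) ?_ (ae_of_all _ fun z => (Circle.norm_coe _).le)
    have hc : Continuous fun z : K × K => ((χ.char (-(z.1 * z.2)) : Circle) : ℂ) :=
      continuous_subtype_val.comp
        (χ.continuous_char.comp (continuous_fst.mul continuous_snd).neg)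
    exact hc.aestronglyMeasurable
  simp only [fourierIntegral]
  rw [integral_integral_swap hint]
  simp only [integral_const_mul, hB, integral_charFun_closedBall H χ n]
  rw [← integral_const_mul, ← integral_indicator measurableSet_closedBall]
  congr 1
  ext x
  by_cases hx : x ∈ closedBall (0 : K) ((p : ℝ) ^ (n : ℤ))
  · rw [Set.indicator_of_mem hx, Set.indicator_of_mem hx, mul_comm]
  · rw [Set.indicator_of_notMem hx, Set.indicator_of_notMem hx, mul_zero]

namespace IsNormalized

theorem exists_zpow_neg_lt (H : IsNormalized p μ) {δ : ℝ} (hδ : 0 < δ) :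
    ∃ N : ℕ, ∀ M : ℕ, N ≤ M → (p : ℝ) ^ (-(M : ℤ)) < δ := by
  obtain ⟨N, hN⟩ := exists_pow_lt_of_lt_one hδ (inv_lt_one_of_one_lt₀ H.one_lt)
  refine ⟨N, fun M hM => lt_of_le_of_lt ?_ hN⟩
  rw [inv_pow, ← zpow_natCast, ← zpow_neg]
  exact zpow_le_zpow_right₀ H.one_lt.le (by lia)

theorem max_one_norm_rpow_eq (H : IsNormalized p μ) (θ : ℝ) {N : ℕ} {x : K}
    (hx : ‖x‖ ≤ (p : ℝ) ^ (N : ℤ)) :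
    max 1 ‖x‖ ^ θ = ((p : ℝ) ^ θ) ^ N + ∑ n ∈ Finset.range N,
      if ‖x‖ ≤ (p : ℝ) ^ (n : ℤ) then (1 - (p : ℝ) ^ θ) * ((p : ℝ) ^ θ) ^ n else 0 := by
  have hp := H.pos
  obtain ⟨m, hm, hiff⟩ : ∃ m : ℕ, max 1 ‖x‖ = (p : ℝ) ^ m ∧
      ∀ n : ℕ, ‖x‖ ≤ (p : ℝ) ^ (n : ℤ) ↔ m ≤ n := by
    rcases le_or_gt ‖x‖ 1 with h | h
    · refine ⟨0, by simp [h], fun n => ?_⟩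
      simpa using h.trans (one_le_pow₀ H.one_lt.le)
    · obtain ⟨k, hk⟩ := H.norm_eq_zpow x (norm_pos_iff.1 (one_pos.trans h))
      have hk1 := h
      rw [hk, one_lt_zpow_iff_right₀ H.one_lt] at hk1
      refine ⟨k.natAbs, ?_, fun n => ?_⟩
      · rw [max_eq_right h.le, hk, ← zpow_natCast]
        congr 1; lia
      · rw [hk, zpow_le_zpow_iff_right₀ H.one_lt]
        lia
  have hpow : max 1 ‖x‖ ^ θ = ((p : ℝ) ^ θ) ^ m := by
    rw [hm, ← Real.rpow_natCast, ← Real.rpow_natCast, ← Real.rpow_mul hp.le,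
      ← Real.rpow_mul hp.le, mul_comm]
  simp only [hiff, hpow]
  exact pow_eq_pow_add_sum_layers _ ((hiff N).1 hx)

theorem exists_const_on_closedBall [IsUltrametricDist K] (H : IsNormalized p μ)
    (φ : Schwartz K) :
    ∃ N : ℕ, ∀ M : ℕ, N ≤ M → ∀ x, ‖x‖ ≤ (p : ℝ) ^ (-(M : ℤ)) → φ.1 x = φ.1 0 := by
  obtain ⟨δ, hδ, h⟩ := Schwartz.exists_translation_invariant φ
  obtain ⟨N, hN⟩ := H.exists_zpow_neg_lt hδ
  refine ⟨N, fun M hM x hx => ?_⟩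
  simpa using h 0 x (hx.trans_lt (hN M hM))

variable [ProperSpace K]

theorem layerFunctional_tendsto [IsFiniteMeasureOnCompacts μ] (θ : ℝ) (N : ℕ)
    {ψ : ℕ → K → ℂ} (hψ : TendstoUniformly ψ 0 atTop) :
    Tendsto (fun k => layerFunctional p μ θ N (ψ k)) atTop (𝓝 0) := by
  have h0 : Tendsto (fun k => ψ k 0) atTop (𝓝 0) := hψ.tendsto_at 0
  have hI : ∀ r : ℝ, Tendsto (fun k => ∫ x in closedBall (0 : K) r, ψ k x ∂μ) atTop (𝓝 0) := by
    intro r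
    rw [Metric.tendsto_nhds]
    intro ε hε
    have hm : 0 < μ.real (closedBall (0 : K) r) + 1 := by positivity
    filter_upwards [Metric.tendstoUniformly_iff.1 hψ _ (div_pos hε hm)] with k hk
    rw [dist_zero_right]
    calc _ ≤ ε / (μ.real (closedBall (0 : K) r) + 1) * μ.real (closedBall (0 : K) r) :=
          norm_setIntegral_le_of_norm_le_const (isCompact_closedBall _ _).measure_lt_top
            fun x _ => by simpa using (hk x).le
      _ < ε := by
          rw [div_mul_eq_mul_div, div_lt_iff₀ hm]
          nlinarith
  have h := (h0.const_mul ((((p : ℝ) ^ θ) ^ N : ℝ) : ℂ)).add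
    (tendsto_finsetSum (Finset.range N) fun n _ =>
      (hI ((p : ℝ) ^ (-(n : ℤ)))).const_mul
        (((1 - (p : ℝ) ^ θ) * ((p : ℝ) ^ (θ + 1)) ^ n : ℝ) : ℂ))
  simpa [layerFunctional] using h

variable [BorelSpace K]

theorem isTemperedDistribution_kappa [IsUltrametricDist K] [NullSingletonClass μ]
    [IsFiniteMeasureOnCompacts μ]
    (H : IsNormalized p μ) (θ : ℝ) : IsTemperedDistribution (kappa (K := K) p μ θ) where
  map_add φ ψ := by
    obtain ⟨N₁, h₁⟩ := H.exists_const_on_closedBall φ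
    obtain ⟨N₂, h₂⟩ := H.exists_const_on_closedBall ψ
    have hφ := h₁ (max N₁ N₂) (le_max_left _ _)
    have hψ := h₂ (max N₁ N₂) (le_max_right _ _)
    have hadd : ∀ x, (φ + ψ).1 x = φ.1 x + ψ.1 x := fun _ => rfl
    rw [H.kappa_eq_layerFunctional θ φ hφ, H.kappa_eq_layerFunctional θ ψ hψ,
      H.kappa_eq_layerFunctional θ (φ + ψ) fun x hx => by simp only [hadd, hφ x hx, hψ x hx]]
    simp only [layerFunctional, hadd]
    simp only [integral_add (Schwartz.integrable φ).integrableOn (Schwartz.integrable ψ).integrableOn, mul_add,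
      Finset.sum_add_distrib]
    ring
  map_smul c φ := by
    obtain ⟨N, h⟩ := H.exists_const_on_closedBall φ
    have hφ := h N le_rfl
    have hsmul : ∀ x, (c • φ).1 x = c * φ.1 x := fun _ => rfl
    rw [H.kappa_eq_layerFunctional θ φ hφ,
      H.kappa_eq_layerFunctional θ (N := N) (c • φ) fun x hx => by simp only [hsmul, hφ x hx]]
    simp only [layerFunctional, hsmul, integral_const_mul, mul_add, Finset.mul_sum]
    simp only [mul_left_comm c]
  continuous φ hφ := by
    obtain ⟨-, ⟨δ, hδ, hinv⟩, hlim⟩ := hφ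
    -- The common invariance radius gives one `N` for the whole sequence; for fixed `N` the layer
    -- functional is continuous under uniform convergence.
    obtain ⟨N, hN⟩ := H.exists_zpow_neg_lt hδ
    have heq : ∀ n, kappa p μ θ (φ n) = layerFunctional p μ θ N (φ n).1 := fun n =>
      H.kappa_eq_layerFunctional θ (φ n) fun x hx => by
        simpa using hinv n 0 x (hx.trans (hN N le_rfl).le)
    simp only [heq]
    exact layerFunctional_tendsto θ N hlim

/-- If `φ` is supported in `|x| ≤ p^N`, its transform is constant on `|ξ| ≤ p^(-N)`. The same `N`
truncates both layer expansions, and they agree term by term. -/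
theorem fourierDistribution_kappa [IsUltrametricDist K] [NullSingletonClass μ]
    [μ.IsAddHaarMeasure] (H : IsNormalized p μ) (χ : StandardCharacter K p) (θ : ℝ) :
    fourierDistribution χ μ (kappa p μ θ)
      = ofFunction μ (fun ξ : K => ((max 1 ‖ξ‖ ^ θ : ℝ) : ℂ)) := by
  have hp := H.pos
  funext φ
  obtain ⟨R, hR⟩ := φ.2.2.isBounded.exists_norm_le
  obtain ⟨N, hN⟩ := pow_unbounded_of_one_lt R H.one_lt
  have hsupp : ∀ x, (p : ℝ) ^ (N : ℤ) < ‖x‖ → φ.1 x = 0 := fun x hx => by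
    refine image_eq_zero_of_notMem_tsupport fun h => ?_
    rw [zpow_natCast] at hx
    exact absurd ((hR x h).trans hN.le) (not_le.2 hx)
  have hconst : ∀ ξ, ‖ξ‖ ≤ (p : ℝ) ^ (-(N : ℤ)) →
      (fourierSchwartz χ μ φ).1 ξ = ∫ x, φ.1 x ∂μ := by
    intro ξ hξ
    change ∫ x, φ.1 x * (χ.char (-(ξ * x)) : ℂ) ∂μ = _
    congr 1
    ext x
    rcases le_or_gt ‖x‖ ((p : ℝ) ^ (N : ℤ)) with h | h
    · have : ‖-(ξ * x)‖ ≤ 1 := by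
        rw [norm_neg, norm_mul]
        calc ‖ξ‖ * ‖x‖ ≤ (p : ℝ) ^ (-(N : ℤ)) * (p : ℝ) ^ (N : ℤ) := by gcongr
          _ = 1 := by rw [← zpow_add₀ hp.ne']; simp
      rw [χ.trivial_on_integers _ this, Circle.coe_one, mul_one]
    · rw [hsupp x h, zero_mul]
  have hzero := hconst 0 (by simp)
  have hterm : ∀ n : ℕ, Integrable (fun x => (((1 - (p : ℝ) ^ θ) * ((p : ℝ) ^ θ) ^ n : ℝ) : ℂ) *
      (closedBall (0 : K) ((p : ℝ) ^ (n : ℤ))).indicator φ.1 x) μ := fun n =>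
    ((Schwartz.integrable φ).indicator measurableSet_closedBall).const_mul _
  have hpt : (fun x => ((max 1 ‖x‖ ^ θ : ℝ) : ℂ) * φ.1 x)
      = fun x => ((((p : ℝ) ^ θ) ^ N : ℝ) : ℂ) * φ.1 x + ∑ n ∈ Finset.range N,
        (((1 - (p : ℝ) ^ θ) * ((p : ℝ) ^ θ) ^ n : ℝ) : ℂ) *
          (closedBall (0 : K) ((p : ℝ) ^ (n : ℤ))).indicator φ.1 x := by
    ext x
    rcases le_or_gt ‖x‖ ((p : ℝ) ^ (N : ℤ)) with h | h
    · rw [H.max_one_norm_rpow_eq θ h, Complex.ofReal_add, add_mul, Complex.ofReal_sum,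
        Finset.sum_mul]
      congr 1
      refine Finset.sum_congr rfl fun n _ => ?_
      by_cases hn : ‖x‖ ≤ (p : ℝ) ^ (n : ℤ)
      · rw [if_pos hn, Set.indicator_of_mem (by simpa using hn)]
      · rw [if_neg hn, Set.indicator_of_notMem (by simpa using hn)]
        simp
    · have h0 : ∀ n : ℕ, (closedBall (0 : K) ((p : ℝ) ^ (n : ℤ))).indicator φ.1 x = 0 := fun n =>
        Set.indicator_apply_eq_zero.2 fun _ => hsupp x h
      simp only [h0, hsupp x h, mul_zero, Finset.sum_const_zero, add_zero]
  rw [fourierDistribution, H.kappa_eq_layerFunctional θ _ fun ξ hξ => (hconst ξ hξ).trans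
    hzero.symm, layerFunctional, hzero, ofFunction, hpt,
    integral_add ((Schwartz.integrable φ).const_mul _) (integrable_finsetSum _ fun n _ => hterm n),
    integral_const_mul, integral_finsetSum _ fun n _ => hterm n]
  congr 1
  refine Finset.sum_congr rfl fun n _ => ?_
  rw [integral_const_mul, integral_indicator measurableSet_closedBall]
  change _ * ∫ ξ in closedBall (0 : K) ((p : ℝ) ^ (-(n : ℤ))), fourierIntegral χ μ φ.1 ξ ∂μ = _
  rw [integral_fourierIntegral_closedBall H, ← mul_assoc, ← Complex.ofReal_mul]
  congr 2
  rw [Real.rpow_add_one hp.ne', mul_pow, zpow_neg, zpow_natCast]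
  field_simp

theorem integrable_sobolev_weight [IsFiniteMeasureOnCompacts μ] (H : IsNormalized p μ)
    {s θ : ℝ} (hs : s < -(1 + 2 * θ) / 2) :
    Integrable (fun ξ : K => (1 + ‖ξ‖ ^ 2) ^ s * ‖((max 1 ‖ξ‖ ^ θ : ℝ) : ℂ)‖ ^ 2) μ := by
  have hnorm : ∀ ξ : K, ‖((max 1 ‖ξ‖ ^ θ : ℝ) : ℂ)‖ = max 1 ‖ξ‖ ^ θ := fun ξ => by
    rw [Complex.norm_real, Real.norm_of_nonneg (Real.rpow_nonneg (by positivity) _)]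
  simp only [hnorm]
  have hc : Continuous fun ξ : K => (1 + ‖ξ‖ ^ 2) ^ s * (max 1 ‖ξ‖ ^ θ) ^ 2 :=
    ((continuous_const.add (continuous_norm.pow 2)).rpow_const fun ξ =>
      Or.inl (add_pos_of_pos_of_nonneg one_pos (sq_nonneg _)).ne').mul ((continuous_max_one_norm_rpow θ).pow 2)
  -- The hypothesis on `s` says exactly that this `α` is negative; on the compact unit ball
  -- continuity suffices.
  obtain ⟨hI, -⟩ := H.norm_rpow_integral_compl_closedBall (K := K) (α := 2 * s + 2 * θ + 1)
    (by linarith)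
  rw [← integrableOn_univ, ← Set.union_compl_self (closedBall (0 : K) 1)]
  refine (hc.continuousOn.integrableOn_compact (isCompact_closedBall _ _)).union ?_
  refine (hI.const_mul (max 1 (2 ^ s))).mono' hc.aestronglyMeasurable ?_
  refine (ae_restrict_iff' measurableSet_closedBall.compl).2 (ae_of_all _ fun ξ hξ => ?_)
  rw [Set.mem_compl_iff, mem_closedBall, dist_zero_right, not_le] at hξ
  rw [Real.norm_of_nonneg (mul_nonneg (Real.rpow_nonneg (by positivity) _) (sq_nonneg _)),
    max_eq_right hξ.le]
  exact norm_rpow_mul_sq_le hξ s θ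

end IsNormalized

end

end LocalFieldSobolev

theorem mainTheorem11 {K : Type*} [NontriviallyNormedField K] [IsUltrametricDist K]
    [LocallyCompactSpace K] [MeasurableSpace K] [BorelSpace K]
    (p : ℕ) (hp : p.Prime)
    (hres : Nat.card
      (IsLocalRing.ResidueField (NormedField.valuation (K := K)).valuationSubring) = p)
    (hprime : ∃ ϖ : K, ‖ϖ‖ = (p : ℝ)⁻¹ ∧ ∀ x : K, ‖x‖ < 1 → ‖x‖ ≤ ‖ϖ‖)
    (χ : LocalFieldSobolev.StandardCharacter K p)
    (μ : MeasureTheory.Measure K) [μ.IsAddHaarMeasure]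
    (hμ : μ (Metric.closedBall 0 1) = 1)
    (θ : ℝ) :
    LocalFieldSobolev.IsTemperedDistribution (LocalFieldSobolev.kappa p μ θ) ∧
    LocalFieldSobolev.fourierDistribution χ μ (LocalFieldSobolev.kappa p μ θ) =
      LocalFieldSobolev.ofFunction μ (fun ξ : K => ((max 1 ‖ξ‖ ^ θ : ℝ) : ℂ)) ∧
    ∀ s : ℝ, s < -(1 + 2 * θ) / 2 →
      LocalFieldSobolev.MemSobolev χ μ s (LocalFieldSobolev.kappa p μ θ) := by
  have : ProperSpace K := ProperSpace.of_locallyCompactSpace K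
  have H := LocalFieldSobolev.isNormalized hp hres hprime hμ
  have hT := H.isTemperedDistribution_kappa θ
  have hF := H.fourierDistribution_kappa χ θ
  exact ⟨hT, hF, fun s hs => ⟨hT, _, (Complex.continuous_ofReal.comp
    (LocalFieldSobolev.continuous_max_one_norm_rpow θ)).locallyIntegrable, hF,
    H.integrable_sobolev_weight hs⟩⟩
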